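/- Let $G$ be a finite group and let $\alpha:G\times G\to\mathbb{C}^\times$ be a cocycle, i.e. $\alpha(x,y)\alpha(xy,z)=\alpha(x,yz)\alpha(y,z)$ for all $x,y,z\in G$. Let $\rho$ be a unitary action of $G$ for $\alpha$ on a finite-dimensional complex inner product space $V$, i.e. each $\rho(g)$ is a unitary map of $V$ and $\rho(g)\rho(h)=\alpha(g,h)\rho(gh)$ for all $g,h\in G$. Let $(\mathbb{C}G)_\alpha$ be the $\alpha$-twisted group algebra, i.e. the formal complex linear combinations of elements of $G$ with the bilinear multiplication determined by $g\cdot_\alpha h=\alpha(g,h)\,gh$; then $V$ is a $(\mathbb{C}G)_\alpha$-module via $\bigl(\sum_g a_g g\bigr)\cdot x=\sum_g a_g\rho(g)x$. Let $V=\bigoplus_j V_j$ be a (finite) orthogonal direct sum of irreducible $(\mathbb{C}G)_\alpha$-submodules, and let $v=\sum_j v_j$ with $v_j\in V_j$. Then $(\rho(g)v)_{g\in G}$ is a normalised tight frame for $V$, i.e. $$ f=\sum_{g\in G}\langle f,\rho(g)v\rangle\,\rho(g)v\qquad\text{for all } f\in V, $$ if and only if $$ \|v_j\|^2=\frac{\dim(V_j)}{|G|}\quad\text{for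 all } j, $$ and $$ \langle\sigma v_j,v_k\rangle=0\quad\text{whenever } j\neq k \text{ and } \sigma:V_j\to V_k \text{ is a } (\mathbb{C}G)_\alpha\text{-module isomorphism.} $$ -/

import Mathlib

/-- A (2-)cocycle, or multiplier, of a group `G`: a map `α : G × G → ℂˣ` with
`α(x,y) α(xy,z) = α(x,yz) α(y,z)`. -/
structure Cocycle (G : Type*) [Group G] where
  toFun : G → G → ℂˣ
  cocycle' : ∀ x y z : G, toFun x y * toFun (x * y) z = toFun x (y * z) * toFun y z

namespace Cocycle

variable {G : Type*} [Group G]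

instance : CoeFun (Cocycle G) (fun _ => G → G → ℂˣ) := ⟨Cocycle.toFun⟩

/-- The cocycle rule, read in `ℂ`. -/
theorem rule (α : Cocycle G) (x y z : G) :
    (α x y : ℂ) * (α (x * y) z : ℂ) = (α x (y * z) : ℂ) * (α y z : ℂ) := by
  have h := congrArg Units.val (α.cocycle' x y z)
  simpa using h

theorem one_left (α : Cocycle G) (g : G) : α 1 g = α 1 1 := by
  have h := α.cocycle' 1 1 g
  simp only [one_mul] at h
  exact (mul_right_cancel h).symm

theorem one_right (α : Cocycle G) (g : G) : α g 1 = α 1 1 := by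
  have h := α.cocycle' g 1 1
  simp only [mul_one] at h
  exact mul_left_cancel h

end Cocycle

/-- The `α`-twisted group algebra `(ℂG)_α` of a finite group `G`: formal linear combinations
`∑ a(g) g` of the elements of `G` (represented by their coefficient functions), with the bilinear
multiplication determined by `g ·_α h = α(g,h) gh`. -/
def TwistedGroupAlgebra {G : Type*} [Group G] (_ : Cocycle G) : Type _ := G → ℂ

namespace TwistedGroupAlgebra

variable {G : Type*} [Group G] {α : Cocycle G}

instance : AddCommGroup (TwistedGroupAlgebra α) := inferInstanceAs (AddCommGroup (G → ℂ))

instance : Module ℂ (TwistedGroupAlgebra α) := inferInstanceAs (Module ℂ (G → ℂ))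

/-- The coefficient of `g` in a formal linear combination. -/
def coeff (a : TwistedGroupAlgebra α) (g : G) : ℂ := a g

@[ext] theorem ext {a b : TwistedGroupAlgebra α} (h : ∀ g, a.coeff g = b.coeff g) : a = b :=
  funext h

open Classical in
/-- The formal linear combination `z g`. -/
noncomputable def single (g : G) (z : ℂ) : TwistedGroupAlgebra α := fun x => if x = g then z else 0

open Classical in
theorem coeff_single (g : G) (z : ℂ) (x : G) :
    (single g z : TwistedGroupAlgebra α).coeff x = if x = g then z else 0 := rfl

@[simp] theorem coeff_add (a b : TwistedGroupAlgebra α) (g : G) :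
    (a + b).coeff g = a.coeff g + b.coeff g := rfl

@[simp] theorem coeff_smul (z : ℂ) (a : TwistedGroupAlgebra α) (g : G) :
    (z • a).coeff g = z * a.coeff g := rfl

@[simp] theorem coeff_zero (g : G) : (0 : TwistedGroupAlgebra α).coeff g = 0 := rfl

variable [Fintype G]

noncomputable instance : Mul (TwistedGroupAlgebra α) :=
  ⟨fun a b x => ∑ g : G, (α g (g⁻¹ * x) : ℂ) * a.coeff g * b.coeff (g⁻¹ * x)⟩

/-- The identity of `(ℂG)_α` is `α(1,1)⁻¹ 1`. -/
noncomputable instance : One (TwistedGroupAlgebra α) := ⟨single 1 ((α 1 1 : ℂ)⁻¹)⟩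

theorem coeff_mul (a b : TwistedGroupAlgebra α) (x : G) :
    (a * b).coeff x = ∑ g : G, (α g (g⁻¹ * x) : ℂ) * a.coeff g * b.coeff (g⁻¹ * x) := rfl

theorem one_def : (1 : TwistedGroupAlgebra α) = single 1 ((α 1 1 : ℂ)⁻¹) := rfl

theorem protected_mul_assoc (a b c : TwistedGroupAlgebra α) : a * b * c = a * (b * c) := by
  ext x
  simp only [coeff_mul, Finset.sum_mul, Finset.mul_sum]
  rw [Finset.sum_comm]
  refine Finset.sum_congr rfl fun g _ => ?_
  rw [← Equiv.sum_comp (Equiv.mulLeft g)]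
  refine Finset.sum_congr rfl fun k _ => ?_
  have h := α.rule g k (k⁻¹ * (g⁻¹ * x))
  simp only [Equiv.coe_mulLeft, mul_inv_rev, inv_mul_cancel_left, mul_assoc] at h ⊢
  rw [mul_inv_cancel_left] at h
  linear_combination (a.coeff g * b.coeff k * c.coeff (k⁻¹ * (g⁻¹ * x))) * h

theorem protected_one_mul (a : TwistedGroupAlgebra α) : 1 * a = a := by
  ext x
  rw [coeff_mul, Finset.sum_eq_single 1]
  · simp [one_def, coeff_single, α.one_left x]
  · intro g _ hg
    simp [one_def, coeff_single, hg]
  · simp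

theorem protected_mul_one (a : TwistedGroupAlgebra α) : a * 1 = a := by
  ext x
  rw [coeff_mul, Finset.sum_eq_single x]
  · simp only [one_def, coeff_single, inv_mul_cancel, α.one_right x, if_true]
    rw [mul_right_comm, mul_inv_cancel₀ (Units.ne_zero _), one_mul]
  · intro g _ hg
    have : g⁻¹ * x ≠ 1 := fun h => hg (inv_mul_eq_one.mp h)
    simp [one_def, coeff_single, this]
  · simp

noncomputable instance : Ring (TwistedGroupAlgebra α) where
  mul_assoc := protected_mul_assoc
  one_mul := protected_one_mul
  mul_one := protected_mul_one
  left_distrib a b c := by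
    ext x; simp [coeff_mul, mul_add, Finset.sum_add_distrib]
  right_distrib a b c := by
    ext x; simp [coeff_mul, mul_add, add_mul, Finset.sum_add_distrib]
  zero_mul a := by ext x; simp [coeff_mul]
  mul_zero a := by ext x; simp [coeff_mul]
  zsmul := fun n a => n • a
  zsmul_zero' := zero_zsmul
  zsmul_succ' n a := by rw [natCast_zsmul, natCast_zsmul, succ_nsmul]
  zsmul_neg' n a := negSucc_zsmul a n
  nsmul := fun n a => n • a
  nsmul_zero := zero_nsmul
  nsmul_succ n a := succ_nsmul a n
  sub_eq_add_neg a b := sub_eq_add_neg a b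
  neg_add_cancel a := neg_add_cancel a

/-- The defining multiplication rule `g ·_α h = α(g,h) gh`. -/
theorem single_mul_single (g h : G) :
    (single g 1 * single h 1 : TwistedGroupAlgebra α) = single (g * h) (α g h : ℂ) := by
  ext x
  rw [coeff_mul, Finset.sum_eq_single g]
  · by_cases hx : x = g * h
    · subst hx; simp [coeff_single]
    · have : g⁻¹ * x ≠ h := fun e => hx (by rw [← e, mul_inv_cancel_left])
      simp [coeff_single, hx, this]
  · intro k _ hk; simp [coeff_single, hk]
  · simp

noncomputable instance : Algebra ℂ (TwistedGroupAlgebra α) :=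
  Algebra.ofModule
    (fun z a b => by ext x; simp only [coeff_mul, coeff_smul, Finset.mul_sum]
                     exact Finset.sum_congr rfl fun g _ => by ring)
    (fun z a b => by ext x; simp only [coeff_mul, coeff_smul, Finset.mul_sum]
                     exact Finset.sum_congr rfl fun g _ => by ring)

end TwistedGroupAlgebra

/-- A unitary projective representation (unitary action) of `G` on `V` for the cocycle `α`:
unitary maps `ρ(g)` with `ρ(g) ρ(h) = α(g,h) ρ(gh)`. -/
structure UnitaryAction {G : Type*} [Group G] (α : Cocycle G)
    (V : Type*) [NormedAddCommGroup V] [InnerProductSpace ℂ V] where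
  toFun : G → V ≃ₗᵢ[ℂ] V
  apply_apply' : ∀ (g h : G) (x : V), toFun g (toFun h x) = (α g h : ℂ) • toFun (g * h) x

namespace UnitaryAction

variable {G : Type*} [Group G] {α : Cocycle G}
  {V : Type*} [NormedAddCommGroup V] [InnerProductSpace ℂ V]

instance : CoeFun (UnitaryAction α V) (fun _ => G → V ≃ₗᵢ[ℂ] V) := ⟨UnitaryAction.toFun⟩

theorem apply_one (ρ : UnitaryAction α V) (x : V) : ρ 1 x = (α 1 1 : ℂ) • x := by
  apply (ρ 1).injective
  rw [ρ.apply_apply', map_smul, one_mul]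

/-- The inner product space `V`, regarded as a `(ℂG)_α`-module through `ρ`. -/
def AsModule (_ : UnitaryAction α V) : Type _ := V

variable (ρ : UnitaryAction α V)

instance : NormedAddCommGroup ρ.AsModule := inferInstanceAs (NormedAddCommGroup V)

instance : InnerProductSpace ℂ ρ.AsModule := inferInstanceAs (InnerProductSpace ℂ V)

/-- The identity map between `V` as a `(ℂG)_α`-module and `V`. -/
def asModuleEquiv : ρ.AsModule ≃ₗᵢ[ℂ] V := LinearIsometryEquiv.refl ℂ V

variable [Fintype G]

/-- `(∑ a(g) g) · x = ∑ a(g) ρ(g) x`. -/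
noncomputable instance : SMul (TwistedGroupAlgebra α) ρ.AsModule :=
  ⟨fun a x => ρ.asModuleEquiv.symm (∑ g : G, a.coeff g • ρ g (ρ.asModuleEquiv x))⟩

theorem smul_def (a : TwistedGroupAlgebra α) (x : ρ.AsModule) :
    a • x = ρ.asModuleEquiv.symm (∑ g : G, a.coeff g • ρ g (ρ.asModuleEquiv x)) := rfl

/-- The module structure extends `g · x = ρ(g) x`. -/
theorem single_smul (g : G) (z : ℂ) (x : ρ.AsModule) :
    (TwistedGroupAlgebra.single g z : TwistedGroupAlgebra α) • x =
      z • ρ.asModuleEquiv.symm (ρ g (ρ.asModuleEquiv x)) := by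
  rw [smul_def, Finset.sum_eq_single g]
  · simp [TwistedGroupAlgebra.coeff_single]
  · intro h _ hh
    simp [TwistedGroupAlgebra.coeff_single, hh]
  · simp

noncomputable instance : Module (TwistedGroupAlgebra α) ρ.AsModule where
  one_smul x := by
    rw [smul_def, Finset.sum_eq_single 1]
    · simp [TwistedGroupAlgebra.one_def, TwistedGroupAlgebra.coeff_single, apply_one, smul_smul]
    · intro g _ hg
      simp [TwistedGroupAlgebra.one_def, TwistedGroupAlgebra.coeff_single, hg]
    · simp
  mul_smul a b x := by
    simp only [smul_def, LinearIsometryEquiv.apply_symm_apply, TwistedGroupAlgebra.coeff_mul,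
      map_sum, map_smul, Finset.smul_sum, Finset.sum_smul, apply_apply']
    rw [Finset.sum_comm]
    refine Finset.sum_congr rfl fun g _ => ?_
    rw [← Equiv.sum_comp (Equiv.mulLeft g)]
    refine Finset.sum_congr rfl fun k _ => ?_
    simp only [Equiv.coe_mulLeft, inv_mul_cancel_left, smul_smul]
    congr 1
    ring
  smul_zero a := by simp [smul_def]
  smul_add a x y := by simp [smul_def, Finset.sum_add_distrib]
  add_smul a b x := by simp [smul_def, add_smul, Finset.sum_add_distrib]
  zero_smul x := by simp [smul_def]

instance : IsScalarTower ℂ (TwistedGroupAlgebra α) ρ.AsModule where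
  smul_assoc z a x := by
    simp only [smul_def, TwistedGroupAlgebra.coeff_smul, ← map_smul, Finset.smul_sum, smul_smul]

end UnitaryAction

/-- A finite sequence `(φ_i)` in `V` is a normalised tight (Parseval) frame for `V` if
`f = ∑ ⟨f, φ_i⟩ φ_i` for all `f ∈ V`. In Mathlib the inner product is linear in its second
argument, so the coefficient `⟨f, φ_i⟩` is `inner ℂ (φ i) f`. -/
def IsNormalisedTightFrame {ι V : Type*} [Fintype ι] [NormedAddCommGroup V]
    [InnerProductSpace ℂ V] (φ : ι → V) : Prop :=
  ∀ f : V, f = ∑ i, inner ℂ (φ i) f • φ i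

namespace TwistedGroupAlgebra

variable {G : Type*} [Group G] [Fintype G] {α : Cocycle G}

/-! Put S_{x,y} f = ∑_g ⟨f, gx⟩ gy (`frameMap`). Unitarity makes S_{x,y} commute with the action, so
Schur's lemma applies to it between irreducible submodules. The other tool is a trace formula
(`sum_inner_frameMap`): for x in a submodule W with orthonormal basis (e_i) and a module map L on W,
∑_i ⟨L e_i, S_{x,y} e_i⟩ = |G| ⟨Lx, y⟩.

The frame condition says S_{v,v} = id, and by orthogonality S_{v,v} restricts to S_{v_j,v} = ∑_k
S_{v_j,v_k} on V_j. If S_{v,v} = id, the trace formula with L the identity of V_j gives the norms,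
and with L = σ it gives the orthogonality relations. Conversely, those relations force S_{v_j,v_k} =
0 on V_j for k ≠ j, and the norms force S_{v_j,v_j} = id there. -/

theorem eq_sum_smul_single (a : TwistedGroupAlgebra α) :
    a = ∑ g : G, a.coeff g • (single g 1 : TwistedGroupAlgebra α) := by
  classical
  have key : ∀ (s : Finset G) (x : G),
      (∑ g ∈ s, a.coeff g • (single g 1 : TwistedGroupAlgebra α)).coeff x =
        ∑ g ∈ s, (a.coeff g • (single g 1 : TwistedGroupAlgebra α)).coeff x := by
    intro s x
    induction s using Finset.induction_on with
    | empty => simp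
    | insert b s hb ih => rw [Finset.sum_insert hb, Finset.sum_insert hb, coeff_add, ih]
  ext x
  rw [key, Finset.sum_eq_single x]
  · simp [coeff_single]
  · intro g _ hg
    simp [coeff_single, hg.symm]
  · simp

end TwistedGroupAlgebra

namespace UnitaryAction

open TwistedGroupAlgebra

variable {G : Type*} [Group G] [Fintype G] {α : Cocycle G}
  {V : Type*} [NormedAddCommGroup V] [InnerProductSpace ℂ V] (ρ : UnitaryAction α V)

theorem inner_single_smul (g : G) (x y : ρ.AsModule) :
    inner ℂ ((single g 1 : TwistedGroupAlgebra α) • x) ((single g 1 : TwistedGroupAlgebra α) • y) =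
      inner ℂ x y := by
  rw [single_smul, single_smul, one_smul, one_smul, LinearIsometryEquiv.inner_map_map,
    LinearIsometryEquiv.inner_map_map, LinearIsometryEquiv.inner_map_map]

theorem single_smul_single_smul (g h : G) (x : ρ.AsModule) :
    (single g 1 : TwistedGroupAlgebra α) • (single h 1 : TwistedGroupAlgebra α) • x =
      (α g h : ℂ) • (single (g * h) 1 : TwistedGroupAlgebra α) • x := by
  rw [← mul_smul, single_mul_single, single_smul, single_smul, one_smul]

/-- The values of the cocycle of a nonzero unitary action have modulus one. -/
theorem conj_mul_cocycle (g h : G) {x : ρ.AsModule} (hx : x ≠ 0) :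
    (starRingEnd ℂ) (α g h : ℂ) * (α g h : ℂ) = 1 := by
  have h1 : inner ℂ ((single g 1 : TwistedGroupAlgebra α) • (single h 1 : TwistedGroupAlgebra α) • x)
      ((single g 1 : TwistedGroupAlgebra α) • (single h 1 : TwistedGroupAlgebra α) • x) =
      inner ℂ x x := by rw [inner_single_smul, inner_single_smul]
  -- ρ(g)ρ(h)x and ρ(gh)x have the same norm and differ by the factor α(g,h).
  rw [single_smul_single_smul, inner_smul_left, inner_smul_right, inner_single_smul,
    ← mul_assoc] at h1
  exact mul_right_cancel₀ (inner_self_ne_zero.mpr hx) (h1.trans (one_mul _).symm)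

/-- The mixed frame operator `f ↦ ∑ ⟨f, ρ(g) x⟩ ρ(g) y`, as a `ℂ`-linear map. -/
noncomputable def frameMapAux (x y : ρ.AsModule) : ρ.AsModule →ₗ[ℂ] ρ.AsModule where
  toFun f := ∑ g : G, (inner ℂ ((single g 1 : TwistedGroupAlgebra α) • x) f : ℂ) •
    (single g 1 : TwistedGroupAlgebra α) • y
  map_add' f f' := by simp only [inner_add_right, add_smul, Finset.sum_add_distrib]
  map_smul' z f := by simp only [inner_smul_right, mul_smul, Finset.smul_sum, RingHom.id_apply]

theorem frameMapAux_apply (x y f : ρ.AsModule) :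
    ρ.frameMapAux x y f = ∑ g : G, (inner ℂ ((single g 1 : TwistedGroupAlgebra α) • x) f : ℂ) •
      (single g 1 : TwistedGroupAlgebra α) • y := rfl

/-- After the substitution g = hk, the coefficient contributes the conjugate of α(h,k) and the
vector contributes α(h,k). They cancel because |α(h,k)| = 1, a fact that needs a nonzero vector;
hence the separate case f = 0. -/
theorem frameMapAux_single_smul (x y : ρ.AsModule) (h : G) (f : ρ.AsModule) :
    ρ.frameMapAux x y ((single h 1 : TwistedGroupAlgebra α) • f) =
      (single h 1 : TwistedGroupAlgebra α) • ρ.frameMapAux x y f := by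
  by_cases hf : f = 0
  · simp [hf]
  rw [frameMapAux_apply, frameMapAux_apply, Finset.smul_sum, ← Equiv.sum_comp (Equiv.mulLeft h)]
  refine Finset.sum_congr rfl fun k _ => ?_
  have hα := ρ.conj_mul_cocycle h k hf
  rw [Equiv.coe_mulLeft, smul_comm (single h 1 : TwistedGroupAlgebra α),
    single_smul_single_smul, ← ρ.inner_single_smul h (_ • x) f, single_smul_single_smul,
    inner_smul_left, smul_smul, mul_right_comm, hα, one_mul]

/-- The mixed frame operator `f ↦ ∑ ⟨f, ρ(g) x⟩ ρ(g) y`; it commutes with the action. -/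
noncomputable def frameMap (x y : ρ.AsModule) :
    ρ.AsModule →ₗ[TwistedGroupAlgebra α] ρ.AsModule where
  toFun := ρ.frameMapAux x y
  map_add' := map_add _
  map_smul' a f := by
    rw [eq_sum_smul_single a]
    simp only [Finset.sum_smul, map_sum, smul_assoc, map_smul, frameMapAux_single_smul,
      RingHom.id_apply]

theorem frameMap_apply (x y f : ρ.AsModule) :
    ρ.frameMap x y f = ∑ g : G, (inner ℂ ((single g 1 : TwistedGroupAlgebra α) • x) f : ℂ) •
      (single g 1 : TwistedGroupAlgebra α) • y := rfl

theorem frameMap_mem {W : Submodule (TwistedGroupAlgebra α) ρ.AsModule} (x : ρ.AsModule)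
    {y : ρ.AsModule} (hy : y ∈ W) (f : ρ.AsModule) : ρ.frameMap x y f ∈ W := by
  rw [frameMap_apply]
  exact Submodule.sum_mem _ fun g _ =>
    (W.restrictScalars ℂ).smul_mem _ (W.smul_mem _ hy)

theorem frameMap_sum_right {ι : Type*} (s : Finset ι) (x : ρ.AsModule) (y : ι → ρ.AsModule)
    (f : ρ.AsModule) : ρ.frameMap x (∑ i ∈ s, y i) f = ∑ i ∈ s, ρ.frameMap x (y i) f := by
  simp only [frameMap_apply, Finset.smul_sum]
  exact Finset.sum_comm

theorem isNormalisedTightFrame_iff (v : V) :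
    IsNormalisedTightFrame (fun g : G => ρ g v) ↔
      ∀ f : ρ.AsModule,
        f = ρ.frameMap (ρ.asModuleEquiv.symm v) (ρ.asModuleEquiv.symm v) f := by
  simp only [frameMap_apply, single_smul, one_smul]
  rfl

/-- The trace of the mixed frame operator of `x` and `y`, paired with an equivariant map. -/
theorem sum_inner_frameMap {W : Submodule (TwistedGroupAlgebra α) ρ.AsModule}
    {ι : Type*} [Fintype ι] {e : ι → W}
    (he : ∀ z : W, ∑ i, (inner ℂ (e i : ρ.AsModule) (z : ρ.AsModule) : ℂ) • e i = z)
    (L : W →ₗ[TwistedGroupAlgebra α] ρ.AsModule) (x : W) (y : ρ.AsModule) :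
    ∑ i, inner ℂ (L (e i)) (ρ.frameMap x y (e i : ρ.AsModule)) =
      (Fintype.card G : ℂ) * inner ℂ (L x) y := by
  -- Every g contributes the same amount: ⟨Lx, y⟩ = ⟨gLx, gy⟩ = ⟨L(gx), gy⟩, and gx is then expanded
  -- in the e_i.
  have key : ∀ g : G, ∑ i, inner ℂ (L (e i))
      ((inner ℂ ((single g 1 : TwistedGroupAlgebra α) • (x : ρ.AsModule)) (e i : ρ.AsModule) : ℂ) •
        (single g 1 : TwistedGroupAlgebra α) • y) = inner ℂ (L x) y := by
    intro g
    rw [← ρ.inner_single_smul g (L x) y, ← map_smul, ← he (_ • x), map_sum, sum_inner]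
    refine Finset.sum_congr rfl fun i _ => ?_
    rw [LinearMap.map_smul_of_tower, inner_smul_left, inner_smul_right, inner_conj_symm,
      Submodule.coe_smul]
  simp only [frameMap_apply, inner_sum]
  rw [Finset.sum_comm, Finset.sum_congr rfl fun g _ => key g]
  simp

/-- The mixed frame operator of `x` and `y ∈ W'`, as a map between submodules. -/
noncomputable def frameMapBetween {W W' : Submodule (TwistedGroupAlgebra α) ρ.AsModule}
    (x : W) (y : W') : W →ₗ[TwistedGroupAlgebra α] W' :=
  ((ρ.frameMap x y).comp W.subtype).codRestrict W' fun f => ρ.frameMap_mem x y.2 f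

/-! ### Schur's lemma and the trace formula on irreducible submodules -/

variable [FiniteDimensional ℂ V]

instance : FiniteDimensional ℂ ρ.AsModule := inferInstanceAs (FiniteDimensional ℂ V)

theorem exists_orthonormal_expansion (W : Submodule (TwistedGroupAlgebra α) ρ.AsModule) :
    ∃ e : Fin (Module.finrank ℂ W) → W, (∀ i, ‖(e i : ρ.AsModule)‖ = 1) ∧
      ∀ z : W, ∑ i, (inner ℂ (e i : ρ.AsModule) (z : ρ.AsModule) : ℂ) • e i = z :=
  ⟨fun i => stdOrthonormalBasis ℂ (W.restrictScalars ℂ) i,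
    fun i => (stdOrthonormalBasis ℂ (W.restrictScalars ℂ)).norm_eq_one i,
    fun z => (stdOrthonormalBasis ℂ (W.restrictScalars ℂ)).sum_repr' z⟩

/-- By Schur, S_{x,y} restricts to T : W → W' that is zero or an isomorphism. In the latter case the
trace formula with L = T gives ∑ ‖T e_i‖² = |G| ⟨Tx, y⟩ = 0, so T vanishes anyway. -/
theorem frameMap_eq_zero_of_inner_eq_zero
    {W W' : Submodule (TwistedGroupAlgebra α) ρ.AsModule}
    [IsSimpleModule (TwistedGroupAlgebra α) W] [IsSimpleModule (TwistedGroupAlgebra α) W']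
    (x : W) (y : W') (h : ∀ σ : W ≃ₗ[TwistedGroupAlgebra α] W',
      inner ℂ (σ x : ρ.AsModule) (y : ρ.AsModule) = 0) {f : ρ.AsModule} (hf : f ∈ W) :
    ρ.frameMap x y f = 0 := by
  suffices hT : ρ.frameMapBetween x y = 0 by
    have := congrArg Subtype.val (LinearMap.congr_fun hT ⟨f, hf⟩)
    exact this
  rcases (ρ.frameMapBetween x y).bijective_or_eq_zero with hb | h0
  · obtain ⟨e, -, he⟩ := ρ.exists_orthonormal_expansion W
    have ht := ρ.sum_inner_frameMap he (W'.subtype.comp (ρ.frameMapBetween x y)) x y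
    rw [show inner ℂ ((W'.subtype.comp (ρ.frameMapBetween x y)) x) (y : ρ.AsModule) = 0 from
      h (LinearEquiv.ofBijective _ hb), mul_zero] at ht
    have ht' : ∑ i, ‖ρ.frameMap x y (e i : ρ.AsModule)‖ ^ 2 = 0 := by
      have hre := congrArg Complex.re ht
      rw [Complex.re_sum, Complex.zero_re] at hre
      rw [← hre]
      exact Finset.sum_congr rfl fun i _ =>
        (inner_self_eq_norm_sq (𝕜 := ℂ) (ρ.frameMap x y (e i : ρ.AsModule))).symm
    rw [Finset.sum_eq_zero_iff_of_nonneg fun i _ => sq_nonneg _] at ht'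
    have hzero : ∀ i, ρ.frameMapBetween x y (e i) = 0 := fun i => Subtype.ext
      (norm_eq_zero.mp (pow_eq_zero_iff two_ne_zero |>.mp (ht' i (Finset.mem_univ i))))
    refine LinearMap.ext fun u => ?_
    rw [← he u, map_sum, LinearMap.zero_apply]
    exact Finset.sum_eq_zero fun i _ => by rw [LinearMap.map_smul_of_tower, hzero, smul_zero]
  · exact h0

/-- By Schur over ℂ, S_{x,x} is a scalar c on W. The trace formula with L the inclusion gives c dim
W = |G| ‖x‖² = dim W, so c = 1. -/
theorem frameMap_eq_self_of_norm_sq_eq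
    {W : Submodule (TwistedGroupAlgebra α) ρ.AsModule}
    [IsSimpleModule (TwistedGroupAlgebra α) W] (x : W)
    (h : ‖(x : ρ.AsModule)‖ ^ 2 = (Module.finrank ℂ W : ℝ) / (Fintype.card G : ℝ))
    {f : ρ.AsModule} (hf : f ∈ W) : ρ.frameMap x x f = f := by
  have : FiniteDimensional ℂ W := inferInstanceAs (FiniteDimensional ℂ (W.restrictScalars ℂ))
  have : Nontrivial W := IsSimpleModule.nontrivial (TwistedGroupAlgebra α) W
  obtain ⟨c, hc⟩ := (IsSimpleModule.algebraMap_end_bijective_of_isAlgClosed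
    (A := TwistedGroupAlgebra α) (V := W) ℂ).2 (ρ.frameMapBetween x x)
  have hT : ∀ u : W, ρ.frameMap x x (u : ρ.AsModule) = c • (u : ρ.AsModule) := fun u =>
    congrArg Subtype.val (LinearMap.congr_fun hc u).symm
  obtain ⟨e, he1, he⟩ := ρ.exists_orthonormal_expansion W
  have ht := ρ.sum_inner_frameMap he W.subtype x x
  have hterm : ∀ i, inner ℂ (W.subtype (e i)) (ρ.frameMap x x (e i : ρ.AsModule)) = c := fun i => by
    rw [hT, inner_smul_right, Submodule.subtype_apply, inner_self_eq_one_of_norm_eq_one (he1 i),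
      mul_one]
  have hG : (Fintype.card G : ℝ) ≠ 0 := Nat.cast_ne_zero.mpr Fintype.card_ne_zero
  have hd : (Module.finrank ℂ W : ℂ) ≠ 0 := Nat.cast_ne_zero.mpr Module.finrank_pos.ne'
  have hx : (Fintype.card G : ℂ) * inner ℂ (W.subtype x) (x : ρ.AsModule) =
      (Module.finrank ℂ W : ℂ) := by
    rw [eq_div_iff hG, mul_comm] at h
    rw [Submodule.subtype_apply, inner_self_eq_norm_sq_to_K]
    have h' := congrArg Complex.ofReal h
    push_cast at h'
    exact h'
  rw [hx, Finset.sum_congr rfl fun i _ => hterm i, Finset.sum_const, Finset.card_univ,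
    Fintype.card_fin, nsmul_eq_mul] at ht
  have hc1 : c = 1 := mul_left_cancel₀ hd (ht.trans (mul_one _).symm)
  rw [hT ⟨f, hf⟩, hc1, one_smul]

end UnitaryAction

theorem mainTheorem6
    {G : Type*} [Group G] [Fintype G] (α : Cocycle G)
    {V : Type*} [NormedAddCommGroup V] [InnerProductSpace ℂ V] [FiniteDimensional ℂ V]
    (ρ : UnitaryAction α V)
    {J : Type*} [Fintype J] [DecidableEq J]
    (W : J → Submodule (TwistedGroupAlgebra α) ρ.AsModule)
    (hirr : ∀ j, IsSimpleModule (TwistedGroupAlgebra α) (W j))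
    (hsum : DirectSum.IsInternal W)
    (horth : ∀ j k, j ≠ k → (W j).restrictScalars ℂ ⟂ (W k).restrictScalars ℂ)
    (v : V) (w : ∀ j, W j)
    (hv : ρ.asModuleEquiv.symm v = ∑ j, (w j : ρ.AsModule)) :
    IsNormalisedTightFrame (fun g : G => ρ g v) ↔
      (∀ j, ‖(w j : ρ.AsModule)‖ ^ 2 = (Module.finrank ℂ (W j) : ℝ) / (Fintype.card G : ℝ)) ∧
      (∀ j k, j ≠ k → ∀ σ : W j ≃ₗ[TwistedGroupAlgebra α] W k,
        inner ℂ (σ (w j) : ρ.AsModule) (w k : ρ.AsModule) = 0) := by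
  rw [ρ.isNormalisedTightFrame_iff, hv]
  have horth' : ∀ {j k}, j ≠ k → ∀ {a b : ρ.AsModule}, a ∈ W j → b ∈ W k →
      (inner ℂ a b : ℂ) = 0 := fun hjk _ _ ha hb =>
    (Submodule.isOrtho_iff_inner_eq.mp (horth _ _ hjk)) _ ha _ hb
  have hproj : ∀ {k} {a : ρ.AsModule}, a ∈ W k →
      (inner ℂ a (∑ j, (w j : ρ.AsModule)) : ℂ) = inner ℂ a (w k : ρ.AsModule) := by
    intro k a ha
    rw [inner_sum, Finset.sum_eq_single k (fun j _ hj => horth' hj.symm ha (w j).2) (by simp)]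
  -- For f in `W j`, the translates of the other components are orthogonal to f.
  have hleft : ∀ {j} {f : ρ.AsModule}, f ∈ W j → ∀ y,
      ρ.frameMap (∑ j, (w j : ρ.AsModule)) y f = ρ.frameMap (w j) y f := by
    intro j f hf y
    simp only [UnitaryAction.frameMap_apply]
    refine Finset.sum_congr rfl fun g _ => ?_
    rw [Finset.smul_sum, sum_inner, Finset.sum_eq_single j
      (fun k _ hk => horth' hk ((W k).smul_mem _ (w k).2) hf) (by simp)]
  have hG : (Fintype.card G : ℂ) ≠ 0 := Nat.cast_ne_zero.mpr Fintype.card_ne_zero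
  constructor
  · intro hS
    choose e he1 he using fun j => ρ.exists_orthonormal_expansion (W j)
    -- Stated for arbitrary module maps and with j = k allowed, so that the identity and the
    -- isomorphisms σ are both instances.
    have htrace : ∀ {j k} (σ : W j →ₗ[TwistedGroupAlgebra α] W k),
        ∑ i, (inner ℂ (σ (e j i) : ρ.AsModule) (e j i : ρ.AsModule) : ℂ) =
          (Fintype.card G : ℂ) * inner ℂ (σ (w j) : ρ.AsModule) (w k : ρ.AsModule) := by
      intro j k σ
      rw [← hproj (σ (w j)).2]
      refine Eq.trans (Finset.sum_congr rfl fun i _ => ?_)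
        (ρ.sum_inner_frameMap (he j) ((W k).subtype.comp σ) (w j) _)
      rw [← hleft (e j i).2, ← hS]
      rfl
    refine ⟨fun j => ?_, fun j k hjk σ => ?_⟩
    · have ht := htrace (LinearMap.id : W j →ₗ[TwistedGroupAlgebra α] W j)
      simp only [LinearMap.id_apply] at ht
      rw [Finset.sum_congr rfl fun i _ => inner_self_eq_one_of_norm_eq_one (he1 j i),
        Finset.sum_const, Finset.card_univ, Fintype.card_fin, nsmul_eq_mul, mul_one,
        inner_self_eq_norm_sq_to_K] at ht
      rw [eq_div_iff (Nat.cast_ne_zero.mpr Fintype.card_ne_zero), mul_comm]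
      apply Complex.ofReal_injective
      push_cast
      exact ht.symm
    · have ht := htrace (σ : W j →ₗ[TwistedGroupAlgebra α] W k)
      -- The trace vanishes term by term, since σ moves each basis vector into a submodule
      -- orthogonal to `W j`.
      have h0 : ∀ i, inner ℂ (σ (e j i) : ρ.AsModule) (e j i : ρ.AsModule) = (0 : ℂ) := fun i =>
        horth' hjk.symm (σ (e j i)).2 (e j i).2
      exact (mul_eq_zero.mp (ht.symm.trans (Finset.sum_eq_zero fun i _ => h0 i))).resolve_left hG
  · rintro ⟨hnorm, hcross⟩ f
    have hf : f ∈ ⨆ j, W j := by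
      rw [hsum.submodule_iSup_eq_top]; trivial
    -- The identity is additive in f, so it suffices to check it on each `W j`, where only the
    -- diagonal term survives.
    induction hf using Submodule.iSup_induction' with
    | mem j f hf =>
      have := hirr
      rw [hleft hf, ρ.frameMap_sum_right, Finset.sum_eq_single j
        (fun k _ hk => ρ.frameMap_eq_zero_of_inner_eq_zero (w j) (w k) (hcross j k hk.symm) hf)
        (by simp), ρ.frameMap_eq_self_of_norm_sq_eq (w j) (hnorm j) hf]
    | zero => rw [map_zero]
    | add a b _ _ ha hb => rw [map_add, ← ha, ← hb]
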